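/- Let $G$ be a group and let $\Delta$ be a $G$-set such that, for every subgroup $H\le G$, the fixed point set $\Delta^H$ is nonempty if and only if $H$ is finite (for example the disjoint union of the $G/H$ over all finite subgroups $H\le G$). Modules are $\mathbb{Z}G$-modules, and tensor products over $\mathbb{Z}$ carry the diagonal $G$-action. An exact sequence of $\mathbb{Z}G$-modules is $\mathfrak{F}$-split if it splits over $\mathbb{Z}G$ after applying $-\otimes_{\mathbb{Z}}\mathbb{Z}\Delta$; a module is $\mathfrak{F}$-projective if it is a direct summand of $N\otimes_{\mathbb{Z}}\mathbb{Z}\Delta$ for some module $N$. The $\mathfrak{F}$-cohomological dimension $\mathfrak{F}\mathrm{cd}\,G\in\mathbb{N}\cup\{\infty\}$ is the least $n$ for which there is an $\mathfrak{F}$-split exact sequence $0\to P_n\to\dots\to P_0\to\mathbb{Z}\to 0$ with all $P_i$ $\mathfrak{F}$-projective, where $\mathbb{Z}$ is the trivial module (and $\infty$ if there is no such $n$). A module $M$ is Gorenstein projective if there is an acyclic complex $F=(F_i)_{i\in\mathbb{Z}}$ of projective modules such that $\mathrm{Hom}_{\mathbb{Z}G}(F,Q)$ is acyclic for every projective module $Q$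 and such that the part of $F$ in degrees $\ge 0$ is a projective resolution of $M$. The Gorenstein cohomological dimension $\mathrm{Gcd}\,G\in\mathbb{N}\cup\{\infty\}$ is the least $n$ for which there is an exact sequence $0\to X_n\to\dots\to X_0\to\mathbb{Z}\to 0$ with all $X_i$ Gorenstein projective (and $\infty$ if there is no such $n$). Then $\mathrm{Gcd}\,G\le\mathfrak{F}\mathrm{cd}\,G$. -/

import Mathlib

open CategoryTheory

universe u

/-! `Rep.{u} k G` is the category of `kG`-modules whose underlying type lies in `Type u`. The
notions below are defined over a commutative ring `k` and used for `k = ℤ`. -/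

/-- A `G`-set `Δ` such that, for every subgroup `H` of `G`, the fixed point set `Δ^H` is nonempty
if and only if `H` is finite. -/
def IsFiniteSubgroupGSet (G : Type u) [Group G] (Δ : Type u) [MulAction G Δ] : Prop :=
  ∀ H : Subgroup G, (∃ x : Δ, ∀ h ∈ H, h • x = x) ↔ Finite H

/-- The functor `N ↦ N ⊗ kΔ` on `kG`-modules: tensor product over `k` with the permutation module
of the `G`-set `Δ`, with the diagonal action of `G`. -/
noncomputable def tensorPermutation (k : Type) [CommRing k] (G : Type u) [Group G] (Δ : Type u)
    [MulAction G Δ] : Rep.{u} k G ⥤ Rep.{u} k G where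
  obj N := Rep.of (N.ρ.tprod (Representation.ofMulAction k G Δ))
  map f := Rep.ofHom (f.hom.rTensor (Representation.ofMulAction k G Δ))
  map_id N := by
    ext1
    exact Representation.IntertwiningMap.rTensor_id
  map_comp f g := by
    ext1
    apply Representation.IntertwiningMap.toLinearMap_injective
    exact LinearMap.rTensor_comp _ _ _

instance tensorPermutation_preservesZeroMorphisms (k : Type) [CommRing k]
    (G : Type u) [Group G] (Δ : Type u) [MulAction G Δ] :
    (tensorPermutation k G Δ).PreservesZeroMorphisms where
  map_zero M N := by
    ext1
    exact Representation.IntertwiningMap.rTensor_zero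

/-- A short exact sequence of `kG`-modules is `𝔉`-split if it splits, as a sequence of
`kG`-modules, after tensoring with `kΔ` over `k`. -/
def IsFSplit (k : Type) [CommRing k] (G : Type u) [Group G] (Δ : Type u) [MulAction G Δ]
    (S : ShortComplex (Rep.{u} k G)) : Prop :=
  S.ShortExact ∧ Nonempty (S.map (tensorPermutation k G Δ)).Splitting

/-- A `kG`-module is `𝔉`-projective if it is a direct summand of `N ⊗ kΔ` for some
`kG`-module `N`. -/
def IsFProjective (k : Type) [CommRing k] (G : Type u) [Group G] (Δ : Type u) [MulAction G Δ]
    (M : Rep.{u} k G) : Prop :=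
  ∃ N : Rep.{u} k G, Nonempty (Retract M ((tensorPermutation k G Δ).obj N))

/-- A complex of projective `kG`-modules, indexed by `ℤ` with differentials lowering the degree,
which is acyclic and for which `Hom(F, Q)` is acyclic for every projective `kG`-module `Q`. -/
structure IsTotallyAcyclic {k : Type} [CommRing k] {G : Type u} [Group G]
    (F : ChainComplex (Rep.{u} k G) ℤ) : Prop where
  projective : ∀ i : ℤ, Projective (F.X i)
  acyclic : F.Acyclic
  hom_acyclic : ∀ Q : Rep.{u} k G, Projective Q → ∀ (i : ℤ) (f : F.X i ⟶ Q),
    F.d (i + 1) i ≫ f = 0 → ∃ g : F.X (i - 1) ⟶ Q, F.d i (i - 1) ≫ g = f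

/-- `M` is Gorenstein projective if it has a complete resolution `F` in the strong sense of
coincidence index `0`: `F` is totally acyclic and its part in degrees `≥ 0`, augmented by some
`π : F₀ ⟶ M`, is a projective resolution `⋯ ⟶ F₁ ⟶ F₀ ⟶ M ⟶ 0` of `M`. -/
def IsGorensteinProjective {k : Type} [CommRing k] {G : Type u} [Group G]
    (M : Rep.{u} k G) : Prop :=
  ∃ F : ChainComplex (Rep.{u} k G) ℤ, IsTotallyAcyclic F ∧
    ∃ (π : F.X 0 ⟶ M) (w : F.d 1 0 ≫ π = 0), Epi π ∧ (ShortComplex.mk (F.d 1 0) π w).Exact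

/-- `HasResolution P E n M`: there is a resolution `0 ⟶ Pₙ ⟶ ⋯ ⟶ P₀ ⟶ M ⟶ 0` of `M` by modules
satisfying `P` which is spliced together from short exact sequences
`0 ⟶ Kᵢ₊₁ ⟶ Pᵢ ⟶ Kᵢ ⟶ 0` (with `K₀ = M` and `Kₙ = Pₙ`) belonging to the class `E`. -/
inductive HasResolution {k : Type} [CommRing k] {G : Type u} [Group G] (P : Rep.{u} k G → Prop)
    (E : ShortComplex (Rep.{u} k G) → Prop) : ℕ → Rep.{u} k G → Prop
  | zero (M : Rep.{u} k G) (hM : P M) : HasResolution P E 0 M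
  | succ (n : ℕ) (S : ShortComplex (Rep.{u} k G)) (hS : E S) (h₂ : P S.X₂)
      (h₁ : HasResolution P E n S.X₁) : HasResolution P E (n + 1) S.X₃

/-- The least length of a resolution as in `HasResolution`, and `⊤` if there is none of finite
length. -/
noncomputable def resolutionDimension {k : Type} [CommRing k] {G : Type u} [Group G]
    (P : Rep.{u} k G → Prop) (E : ShortComplex (Rep.{u} k G) → Prop) (M : Rep.{u} k G) : ℕ∞ :=
  ⨅ (n : ℕ) (_ : HasResolution P E n M), (n : ℕ∞)

/-- The trivial `kG`-module `k`. -/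
noncomputable abbrev trivialModule (k : Type) [CommRing k] (G : Type u) [Group G] :
    Rep.{u} k G :=
  Rep.trivial k G (ULift.{u} k)

/-- The `𝔉`-cohomological dimension of `G` (computed with the `G`-set `Δ`): the `𝔉`-projective
dimension of the trivial module, that is the least length of an `𝔉`-split resolution of `ℤ` by
`𝔉`-projective modules. -/
noncomputable def fCohomologicalDimension (G : Type u) [Group G] (Δ : Type u) [MulAction G Δ] :
    ℕ∞ :=
  resolutionDimension (IsFProjective ℤ G Δ) (IsFSplit ℤ G Δ) (trivialModule ℤ G)

/-- The Gorenstein cohomological dimension of `G`: the Gorenstein projective dimension of the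
trivial module, that is the least length of an exact resolution of `ℤ` by Gorenstein projective
modules. -/
noncomputable def gorensteinCohomologicalDimension (G : Type u) [Group G] : ℕ∞ :=
  resolutionDimension IsGorensteinProjective ShortComplex.ShortExact (trivialModule ℤ G)

/-! Only two consequences of the hypothesis on `Δ` matter: `Δ` is nonempty and its stabilizers are
finite. Finiteness gives a `G`-equivariant family of nonempty finite sets `S δ ⊆ G`. A partition of
unity on a module splits the identity, for each `δ`, into finitely many linear pieces indexed by `S
δ`, compatibly with `G`. It lets one pass from `M ⊗ kΔ` to `M ⊗ kG`, by sending `m ⊗ δ` to the sum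
of the `θ δ x m ⊗ x`.

Hence an `𝔉`-projective, `k`-projective module with a partition of unity is projective
(`IsFProjective.projective`). Projective modules themselves carry partitions, and averaging with
these extends maps into them along `k`-split monomorphisms, up to a factor `kΔ` that
`𝔉`-projectivity removes (`IsFProjective.isTotallyExact`).

The universal ring `A` carrying a partition is a polynomial ring, so `k → A` splits over `k`. For
`M` both `𝔉`-projective and `k`-projective, the sequences `M ⊗ kG → M` and `M → M ⊗ A` have
projective middle terms, and their kernel and cokernel are of the same kind. Iterating in both
directions produces a complete resolution, so `M` is Gorenstein projective.

The terms of a given `𝔉`-resolution of `ℤ` need not be `ℤ`-free. Schanuel's lemma therefore replaces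
it by the standard one, built from `0 → J → ℤΔ → ℤ → 0` by tensoring with powers of `J`: its terms
are `ℤ`-projective and `𝔉`-projective, and it stops at the same length. -/

section Tensor

/-! ### Diagonal tensor products and permutation modules. -/

open scoped TensorProduct

variable {k : Type} [CommRing k] {G : Type u} [Group G]

/-- The tensor product over `k` of two `kG`-modules, with the diagonal action. -/
noncomputable abbrev tens (M B : Rep.{u} k G) : Rep.{u} k G := Rep.of (M.ρ.tprod B.ρ)

/-- The functoriality of `tens` in both variables. -/
noncomputable def tensMap {M M' B B' : Rep.{u} k G} (f : M ⟶ M') (g : B ⟶ B') :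
    tens M B ⟶ tens M' B' :=
  Rep.ofHom (f.hom.tensor g.hom)

lemma tens_hom_ext {M B N : Rep.{u} k G} {f g : tens M B ⟶ N}
    (h : ∀ (m : M) (b : B), f.hom (m ⊗ₜ[k] b) = g.hom (m ⊗ₜ[k] b)) : f = g := by
  apply Rep.hom_ext
  apply Representation.IntertwiningMap.toLinearMap_injective
  exact TensorProduct.ext' h

@[simp]
lemma tensMap_id (M B : Rep.{u} k G) : tensMap (𝟙 M) (𝟙 B) = 𝟙 (tens M B) :=
  tens_hom_ext fun _ _ => rfl

lemma tensMap_comp {M M' M'' B B' B'' : Rep.{u} k G} (f : M ⟶ M') (f' : M' ⟶ M'')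
    (g : B ⟶ B') (g' : B' ⟶ B'') :
    tensMap (f ≫ f') (g ≫ g') = tensMap f g ≫ tensMap f' g' :=
  tens_hom_ext fun _ _ => rfl

/-- The functor `M ↦ M ⊗ B`. -/
@[simps]
noncomputable def tensRight (B : Rep.{u} k G) : Rep.{u} k G ⥤ Rep.{u} k G where
  obj M := tens M B
  map f := tensMap f (𝟙 B)
  map_id M := tensMap_id M B
  map_comp _ _ := tens_hom_ext fun _ _ => rfl

instance (B : Rep.{u} k G) : (tensRight B).Additive where
  map_add {_ _ f g} := tens_hom_ext fun m b => TensorProduct.add_tmul (f.hom m) (g.hom m) b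

/-- The functor `B ↦ M ⊗ B`. -/
@[simps]
noncomputable def tensLeft (M : Rep.{u} k G) : Rep.{u} k G ⥤ Rep.{u} k G where
  obj B := tens M B
  map g := tensMap (𝟙 M) g
  map_id B := tensMap_id M B
  map_comp _ _ := tens_hom_ext fun _ _ => rfl

instance (M : Rep.{u} k G) : (tensLeft M).Additive where
  map_add {_ _ f g} := tens_hom_ext fun m b => TensorProduct.tmul_add m (f.hom b) (g.hom b)

/-- The permutation module of a `G`-set. -/
noncomputable abbrev perm (k : Type) [CommRing k] (G : Type u) [Group G] (Δ : Type u)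
    [MulAction G Δ] : Rep.{u} k G :=
  Rep.of (Representation.ofMulAction k G Δ)

/-- Interchange of the last two factors of a tensor product of three modules. -/
noncomputable def tensRightComm (A B C : Rep.{u} k G) :
    tens (tens A B) C ≅ tens (tens A C) B :=
  Rep.mkIso <| .mk (TensorProduct.rightComm k A B C) fun g => by
    ext a b c
    simp

/-- Tensoring with the trivial module `k` does nothing. -/
noncomputable def tensTrivial (M : Rep.{u} k G) : tens M (trivialModule k G) ≅ M :=
  Rep.mkIso <| .mk
    ((TensorProduct.congr (.refl k M) ULift.moduleEquiv).trans (TensorProduct.rid k M)) fun g => by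
      ext m a
      simp

@[simp]
lemma tensTrivial_hom_tmul (M : Rep.{u} k G) (m : M) (a : ULift.{u} k) :
    (tensTrivial M).hom.hom (m ⊗ₜ[k] a) = a.down • m := rfl

section Perm

variable {Δ : Type u} [MulAction G Δ]

/-- The linear map `k[Δ] → V` with prescribed values on `Δ`. -/
noncomputable def permLift {V : Type*} [AddCommGroup V] [Module k V] (φ : Δ → V) :
    MonoidAlgebra k Δ →ₗ[k] V :=
  Finsupp.linearCombination k φ ∘ₗ (MonoidAlgebra.coeffLinearEquiv k).toLinearMap

@[simp]
lemma permLift_single {V : Type*} [AddCommGroup V] [Module k V] (φ : Δ → V) (δ : Δ) (a : k) :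
    permLift φ (MonoidAlgebra.single δ a) = a • φ δ := by
  simp [permLift]

lemma perm_linearMap_ext {V : Type*} [AddCommGroup V] [Module k V]
    {f g : MonoidAlgebra k Δ →ₗ[k] V}
    (h : ∀ δ, f (MonoidAlgebra.single δ 1) = g (MonoidAlgebra.single δ 1)) : f = g := by
  ext δ
  exact h δ

/-- Linear maps `φ δ : M → N` permuted by `G` define a homomorphism `M ⊗ kΔ → N`. -/
noncomputable def tensPermLift {M N : Rep.{u} k G} (φ : Δ → M →ₗ[k] N)
    (h : ∀ (g : G) (δ : Δ) (m : M), φ (g • δ) (M.ρ g m) = N.ρ g (φ δ m)) :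
    tens M (perm k G Δ) ⟶ N :=
  Rep.ofHom ⟨TensorProduct.lift (permLift φ).flip, fun g => by
    ext m δ
    simp [h]⟩

@[simp]
lemma tensPermLift_tmul {M N : Rep.{u} k G} (φ : Δ → M →ₗ[k] N)
    (h : ∀ (g : G) (δ : Δ) (m : M), φ (g • δ) (M.ρ g m) = N.ρ g (φ δ m)) (m : M) (δ : Δ) (a : k) :
    (tensPermLift φ h).hom (m ⊗ₜ[k] MonoidAlgebra.single δ a) = a • φ δ m := by
  change TensorProduct.lift (permLift φ).flip _ = _
  simp

lemma tensPerm_hom_ext {M N : Rep.{u} k G} {f g : tens M (perm k G Δ) ⟶ N}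
    (h : ∀ (m : M) (δ : Δ), f.hom (m ⊗ₜ[k] MonoidAlgebra.single δ (1 : k)) =
      g.hom (m ⊗ₜ[k] MonoidAlgebra.single δ (1 : k))) : f = g := by
  apply Rep.hom_ext
  apply Representation.IntertwiningMap.toLinearMap_injective
  apply TensorProduct.ext
  ext m δ
  exact h m δ

variable (Δ) in
/-- The augmentation `M ⊗ kΔ → M`. -/
noncomputable def tensAug (M : Rep.{u} k G) : tens M (perm k G Δ) ⟶ M :=
  tensPermLift (fun _ => LinearMap.id) fun _ _ _ => rfl

@[simp]
lemma tensAug_tmul (M : Rep.{u} k G) (m : M) (δ : Δ) (a : k) :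
    (tensAug Δ M).hom (m ⊗ₜ[k] MonoidAlgebra.single δ a) = a • m :=
  tensPermLift_tmul _ _ m δ a

lemma tensAug_naturality {M N : Rep.{u} k G} (f : M ⟶ N) :
    tensMap f (𝟙 _) ≫ tensAug Δ N = tensAug Δ M ≫ f :=
  tensPerm_hom_ext fun m δ => by
    change (tensAug Δ N).hom (f.hom m ⊗ₜ[k] MonoidAlgebra.single δ 1) =
      f.hom ((tensAug Δ M).hom (m ⊗ₜ[k] MonoidAlgebra.single δ 1))
    rw [tensAug_tmul, tensAug_tmul, map_smul]

end Perm

end Tensor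

/-! ### Partitions of unity indexed by finite transporters. -/

section PartitionOfUnity

open scoped TensorProduct

/-- A `G`-equivariant assignment of nonempty finite subsets of `G` to the points of `Δ`. -/
structure IsFiniteTransporter {G : Type u} [Group G] {Δ : Type u} [MulAction G Δ]
    (S : Δ → Finset G) : Prop where
  nonempty : ∀ δ, (S δ).Nonempty
  mul_mem : ∀ (g : G) (δ : Δ) (x : G), g * x ∈ S (g • δ) ↔ x ∈ S δ

/-- If all stabilizers are finite, then the sets of group elements that move a chosen
representative of its orbit to `δ` form a finite transporter. -/
lemma exists_isFiniteTransporter {G : Type u} [Group G] {Δ : Type u} [MulAction G Δ]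
    (hΔ : ∀ δ : Δ, Finite (MulAction.stabilizer G δ)) :
    ∃ S : Δ → Finset G, IsFiniteTransporter S := by
  let r : Δ → Δ := fun δ => (Quotient.mk (MulAction.orbitRel G Δ) δ).out
  have hr : ∀ δ, ∃ x : G, x • r δ = δ := fun δ =>
    MulAction.orbitRel_apply.mp (Setoid.symm' _ (Quotient.mk_out (s := MulAction.orbitRel G Δ) δ))
  have hrg : ∀ (g : G) (δ : Δ), r (g • δ) = r δ := fun g δ =>
    congrArg Quotient.out (Quotient.sound (s := MulAction.orbitRel G Δ)
      (MulAction.orbitRel_apply.mpr (MulAction.mem_orbit δ g)))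
  have hfin : ∀ δ, {x : G | x • r δ = δ}.Finite := by
    intro δ
    obtain ⟨x, hx⟩ := hr δ
    have : Set.Finite (MulAction.stabilizer G δ : Set G) := hΔ δ
    -- The set is the coset `Stab(δ) * x`, hence finite.
    refine (this.image (· * x)).subset fun y hy => ⟨y * x⁻¹, ?_, by simp⟩
    rw [Set.mem_ofPred_eq] at hy
    rw [SetLike.mem_coe, MulAction.mem_stabilizer_iff, mul_smul]
    nth_rw 1 [← hx]
    rw [inv_smul_smul, hy]
  refine ⟨fun δ => (hfin δ).toFinset, fun δ => ?_, fun g δ x => ?_⟩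
  · obtain ⟨x, hx⟩ := hr δ
    exact ⟨x, by simpa using hx⟩
  · simp [hrg, mul_smul]

lemma IsFiniteTransporter.sum_smul {G : Type u} [Group G] {Δ : Type u} [MulAction G Δ]
    {S : Δ → Finset G} (hS : IsFiniteTransporter S) {V : Type*} [AddCommMonoid V] (g : G) (δ : Δ)
    (F : G → V) : ∑ x ∈ S (g • δ), F x = ∑ x ∈ S δ, F (g * x) := by
  symm
  refine Finset.sum_bij (fun x _ => g * x) (fun x hx => (hS.mul_mem g δ x).2 hx)
    (fun _ _ _ _ h => mul_left_cancel h) (fun y hy => ⟨g⁻¹ * y, ?_, by simp⟩) fun _ _ => rfl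
  rw [← hS.mul_mem g]
  simpa using hy

variable {k : Type} [CommRing k] {G : Type u} [Group G] {Δ : Type u} [MulAction G Δ]

/-- `M` admits an equivariant family of `k`-linear endomorphisms `θ δ x` such that for each `δ` the
endomorphisms `θ δ x` with `x` in the finite set `S δ` add up to the identity. -/
def HasPartition (S : Δ → Finset G) (M : Rep.{u} k G) : Prop :=
  ∃ θ : Δ → G → M →ₗ[k] M,
    (∀ (g : G) (δ : Δ) (x : G) (m : M), θ (g • δ) (g * x) (M.ρ g m) = M.ρ g (θ δ x m)) ∧
    ∀ (δ : Δ) (m : M), ∑ x ∈ S δ, θ δ x m = m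

lemma HasPartition.of_retract {S : Δ → Finset G} {M N : Rep.{u} k G} (hN : HasPartition S N)
    (h : Retract M N) : HasPartition S M := by
  obtain ⟨θ, hθ, hs⟩ := hN
  refine ⟨fun δ x => h.r.hom.toLinearMap ∘ₗ θ δ x ∘ₗ h.i.hom.toLinearMap, fun g δ x m => ?_,
    fun δ m => ?_⟩
  · change h.r.hom (θ (g • δ) (g * x) (h.i.hom (M.ρ g m))) = M.ρ g (h.r.hom (θ δ x (h.i.hom m)))
    rw [Rep.hom_comm_apply, hθ, Rep.hom_comm_apply]
  · change ∑ x ∈ S δ, h.r.hom (θ δ x (h.i.hom m)) = m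
    rw [← map_sum, hs]
    exact DFunLike.congr_fun (congrArg Rep.Hom.hom h.retract) m

lemma HasPartition.tens_left {S : Δ → Finset G} {B : Rep.{u} k G} (hB : HasPartition S B)
    (M : Rep.{u} k G) : HasPartition S (tens M B) := by
  obtain ⟨θ, hθ, hs⟩ := hB
  refine ⟨fun δ x => (θ δ x).lTensor M, fun g δ x m => ?_, fun δ m => ?_⟩
  · induction m using TensorProduct.induction_on with
    | zero => simp
    | tmul m b => simp [hθ]
    | add a b ha hb => rw [map_add, map_add, ha, hb, ← map_add, ← map_add]
  · induction m using TensorProduct.induction_on with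
    | zero => simp
    | tmul m b => simp [← TensorProduct.tmul_sum, hs]
    | add a b ha hb => simp only [map_add, Finset.sum_add_distrib, ha, hb]

-- For fixed `δ`, each basis element `g` is assigned to the single index `g * c (g⁻¹ • δ)` of `S δ`.
-- Translating the choice by `g` makes this assignment equivariant although `c` itself need not be.
open Classical in
lemma IsFiniteTransporter.hasPartition_leftRegular {S : Δ → Finset G}
    (hS : IsFiniteTransporter S) : HasPartition S (perm k G G) := by
  choose c hc using hS.nonempty
  refine ⟨fun δ x => permLift fun g =>
      if x = g * c (g⁻¹ • δ) then MonoidAlgebra.single g (1 : k) else 0, fun g δ x m => ?_,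
    fun δ m => ?_⟩
  · refine LinearMap.congr_fun (f := permLift _ ∘ₗ (perm k G G).ρ g)
      (g := (perm k G G).ρ g ∘ₗ permLift _) (perm_linearMap_ext fun y => ?_) m
    simp [mul_smul, mul_assoc]
    split_ifs <;> simp
  · refine (LinearMap.sum_apply _ _ _).symm.trans (LinearMap.congr_fun (f := Finset.sum _ _)
      (g := LinearMap.id) (perm_linearMap_ext fun y => ?_) m)
    have : y * c (y⁻¹ • δ) ∈ S δ := by
      simpa using (hS.mul_mem y (y⁻¹ • δ) _).2 (hc (y⁻¹ • δ))
    simp [LinearMap.sum_apply, this]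

/-- A module with a partition of unity which is a retract of `M ⊗ kΔ` via the augmentation is a
retract of `M ⊗ kG`. -/
lemma HasPartition.exists_section {S : Δ → Finset G} (hS : IsFiniteTransporter S)
    {M : Rep.{u} k G} (hM : HasPartition S M) (s : M ⟶ tens M (perm k G Δ))
    (hs : s ≫ tensAug Δ M = 𝟙 M) : ∃ t : M ⟶ tens M (perm k G G), t ≫ tensAug G M = 𝟙 M := by
  obtain ⟨θ, hθ, hsum⟩ := hM
  let j : tens M (perm k G Δ) ⟶ tens M (perm k G G) :=
    tensPermLift (fun δ => ∑ x ∈ S δ, (TensorProduct.mk k M (MonoidAlgebra k G)).flip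
      (MonoidAlgebra.single x 1) ∘ₗ θ δ x) fun g δ m => by
        simp [hS.sum_smul, hθ]
  have hj : j ≫ tensAug G M = tensAug Δ M := by
    refine tensPerm_hom_ext fun m δ => ?_
    change (tensAug G M).hom (j.hom (m ⊗ₜ[k] MonoidAlgebra.single δ 1)) = _
    rw [tensPermLift_tmul, tensAug_tmul]
    simp only [LinearMap.sum_apply, one_smul, map_sum, LinearMap.comp_apply]
    refine (Finset.sum_congr rfl fun x _ => ?_).trans (hsum δ m)
    exact (tensAug_tmul _ _ _ _).trans (one_smul _ _)
  exact ⟨s ≫ j, by rw [Category.assoc, hj, hs]⟩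

/-- If `X` is a `k`-linear direct summand of `Y`, then a homomorphism from `X` to a module with a
partition of unity extends to `Y ⊗ kΔ`. -/
lemma HasPartition.exists_extension {S : Δ → Finset G} (hS : IsFiniteTransporter S)
    {Q : Rep.{u} k G} (hQ : HasPartition S Q) {X Y : Rep.{u} k G} (i : X ⟶ Y) (r : Y →ₗ[k] X)
    (hr : ∀ x, r (i.hom x) = x) (f : X ⟶ Q) :
    ∃ F : tens Y (perm k G Δ) ⟶ Q, tensMap i (𝟙 _) ≫ F = tensAug Δ X ≫ f := by
  obtain ⟨θ, hθ, hsum⟩ := hQ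
  -- The conjugates of `f ∘ r` by the elements of `S δ`, weighted by the partition. On the image of
  -- `X` each conjugate is `f`, so the weights add up to `f`.
  let φ : Δ → Y →ₗ[k] Q := fun δ =>
    ∑ x ∈ S δ, θ δ x ∘ₗ Q.ρ x ∘ₗ f.hom.toLinearMap ∘ₗ r ∘ₗ Y.ρ x⁻¹
  have hφ : ∀ (g : G) (δ : Δ) (m : Y), φ (g • δ) (Y.ρ g m) = Q.ρ g (φ δ m) := fun g δ m => by
    simp [φ, hS.sum_smul, hθ]
  refine ⟨tensPermLift φ hφ, tensPerm_hom_ext fun m δ => ?_⟩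
  change (tensPermLift φ hφ).hom (i.hom m ⊗ₜ[k] MonoidAlgebra.single δ 1) =
    f.hom ((tensAug Δ X).hom (m ⊗ₜ[k] MonoidAlgebra.single δ 1))
  rw [tensPermLift_tmul, tensAug_tmul, one_smul, one_smul, LinearMap.sum_apply]
  refine (Finset.sum_congr rfl fun x _ => ?_).trans (hsum δ _)
  change θ δ x (Q.ρ x (f.hom (r (Y.ρ x⁻¹ (i.hom m))))) = _
  rw [← Rep.hom_comm_apply i, hr, Rep.hom_comm_apply]
  simp

end PartitionOfUnity

/-! ### The universal ring carrying a partition of unity. -/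

section PartitionRing

open scoped Classical in
/-- The generic ring of partitions of unity is the polynomial ring over `k` in the variables
`(δ, x)` with `x ≠ c δ`; this is its element with index `(δ, x)`. -/
noncomputable def partitionElement (k : Type) [CommRing k] {G Δ : Type u} (S : Δ → Finset G)
    (c : Δ → G) (δ : Δ) (x : G) : MvPolynomial {p : Δ × G // p.2 ≠ c p.1} k :=
  if h : x ≠ c δ then MvPolynomial.X ⟨(δ, x), h⟩ else
    1 - ∑ y ∈ (S δ).erase (c δ), if h : y ≠ c δ then MvPolynomial.X ⟨(δ, y), h⟩ else 0

variable {k : Type} [CommRing k] {G : Type u} {Δ : Type u} {S : Δ → Finset G} {c : Δ → G}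

lemma partitionElement_of_ne {δ : Δ} {x : G} (h : x ≠ c δ) :
    partitionElement k S c δ x = MvPolynomial.X ⟨(δ, x), h⟩ :=
  dif_pos h

open scoped Classical in
lemma partitionElement_self (δ : Δ) :
    partitionElement k S c δ (c δ) =
      1 - ∑ y ∈ (S δ).erase (c δ), partitionElement k S c δ y := by
  rw [partitionElement, dif_neg (by simp)]
  congr 1
  refine Finset.sum_congr rfl fun y hy => ?_
  rw [dif_pos (Finset.ne_of_mem_erase hy), partitionElement_of_ne (Finset.ne_of_mem_erase hy)]

lemma sum_partitionElement (hc : ∀ δ, c δ ∈ S δ) (δ : Δ) :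
    ∑ x ∈ S δ, partitionElement k S c δ x = 1 := by
  classical
  rw [← Finset.add_sum_erase _ _ (hc δ), partitionElement_self, sub_add_cancel]

variable [Group G] [MulAction G Δ]

variable (k S c) in
/-- The action of a group element on the generic ring of partitions of unity. -/
noncomputable def partitionRingAct (g : G) :
    MvPolynomial {p : Δ × G // p.2 ≠ c p.1} k →ₐ[k] MvPolynomial {p : Δ × G // p.2 ≠ c p.1} k :=
  MvPolynomial.aeval fun p => partitionElement k S c (g • p.1.1) (g * p.1.2)

lemma partitionRingAct_X (g : G) (p : {p : Δ × G // p.2 ≠ c p.1}) :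
    partitionRingAct k S c g (MvPolynomial.X p) =
      partitionElement k S c (g • p.1.1) (g * p.1.2) :=
  MvPolynomial.aeval_X _ _

/-- For the eliminated index `c δ`, which need not be sent to `c (g • δ)`, the claim follows from
the others: the relation that the elements over `S δ` add up to `1` is carried to the one over `S (g
• δ)`. -/
lemma partitionRingAct_partitionElement (hS : IsFiniteTransporter S) (hc : ∀ δ, c δ ∈ S δ)
    (g : G) (δ : Δ) (x : G) :
    partitionRingAct k S c g (partitionElement k S c δ x) =
      partitionElement k S c (g • δ) (g * x) := by
  classical
  have key : ∀ y, y ≠ c δ → partitionRingAct k S c g (partitionElement k S c δ y) =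
      partitionElement k S c (g • δ) (g * y) := fun y hy => by
    rw [partitionElement_of_ne hy, partitionRingAct_X]
  by_cases hx : x = c δ
  · subst hx
    rw [partitionElement_self, map_sub, map_one, map_sum,
      Finset.sum_congr rfl fun y hy => key y (Finset.ne_of_mem_erase hy), sub_eq_iff_eq_add,
      Finset.add_sum_erase _ (fun y => partitionElement k S c (g • δ) (g * y)) (hc δ),
      ← hS.sum_smul, sum_partitionElement hc]
  · exact key x hx

/-- The generic ring of partitions of unity as a `kG`-module. -/
noncomputable def partitionRing (k : Type) [CommRing k] {G : Type u} [Group G] {Δ : Type u}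
    [MulAction G Δ] {S : Δ → Finset G} (hS : IsFiniteTransporter S) {c : Δ → G}
    (hc : ∀ δ, c δ ∈ S δ) : Rep.{u} k G :=
  Rep.of (X := MvPolynomial {p : Δ × G // p.2 ≠ c p.1} k)
    { toFun := fun g => (partitionRingAct k S c g).toLinearMap
      map_one' := by
        have : partitionRingAct k S c (1 : G) = AlgHom.id k _ := by
          refine MvPolynomial.algHom_ext fun p => ?_
          rw [partitionRingAct_X, one_smul, one_mul,
            partitionElement_of_ne p.2]
          rfl
        rw [this]
        rfl
      map_mul' := fun g h => by
        have : partitionRingAct k S c (g * h) =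
            (partitionRingAct k S c g).comp (partitionRingAct k S c h) := by
          refine MvPolynomial.algHom_ext fun p => ?_
          rw [AlgHom.comp_apply, partitionRingAct_X, partitionRingAct_X, mul_smul, mul_assoc,
            partitionRingAct_partitionElement hS hc]
        rw [this]
        rfl }

variable (k) in
lemma hasPartition_partitionRing (hS : IsFiniteTransporter S) (hc : ∀ δ, c δ ∈ S δ) :
    HasPartition S (partitionRing k hS hc) := by
  refine ⟨fun δ x => LinearMap.mulLeft k (partitionElement k S c δ x),
    fun g δ x (a : MvPolynomial {p : Δ × G // p.2 ≠ c p.1} k) => ?_,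
    fun δ (a : MvPolynomial {p : Δ × G // p.2 ≠ c p.1} k) => ?_⟩
  · change partitionElement k S c (g • δ) (g * x) * partitionRingAct k S c g a =
      partitionRingAct k S c g (partitionElement k S c δ x * a)
    rw [map_mul, partitionRingAct_partitionElement hS hc]
  · change ∑ x ∈ S δ, partitionElement k S c δ x * a = a
    rw [← Finset.sum_mul, sum_partitionElement hc, one_mul]

variable (k) in
/-- The unit of the generic ring of partitions of unity. -/
noncomputable def partitionRingUnit (hS : IsFiniteTransporter S) (hc : ∀ δ, c δ ∈ S δ) :
    trivialModule k G ⟶ partitionRing k hS hc :=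
  Rep.ofHom ⟨(Algebra.linearMap k (MvPolynomial {p : Δ × G // p.2 ≠ c p.1} k)) ∘ₗ
      ULift.moduleEquiv.toLinearMap, fun g => by
    refine LinearMap.ext fun _ => ?_
    exact ((partitionRingAct k S c g).commutes _).symm⟩

/-- There is a `k`-projective module with a partition of unity that contains the trivial module as
a `k`-linear direct summand. -/
lemma IsFiniteTransporter.exists_unit (k : Type) [CommRing k] (hS : IsFiniteTransporter S) :
    ∃ (A : Rep.{u} k G) (η : trivialModule k G ⟶ A) (r : A →ₗ[k] (trivialModule k G)),
      HasPartition S A ∧ Module.Projective k A ∧ ∀ x, r (η.hom x) = x := by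
  choose c hc using hS.nonempty
  refine ⟨partitionRing k hS hc, partitionRingUnit k hS hc,
    ULift.moduleEquiv.symm.toLinearMap ∘ₗ
      -- Evaluation at the origin retracts the unit; it is not `G`-equivariant in general, so the
      -- splitting is only `k`-linear.
      (MvPolynomial.aeval (fun _ => (0 : k)) :
        MvPolynomial {p : Δ × G // p.2 ≠ c p.1} k →ₐ[k] k).toLinearMap,
    hasPartition_partitionRing k hS hc, ?_, fun x => ?_⟩
  · exact inferInstanceAs (Module.Projective k (MvPolynomial {p : Δ × G // p.2 ≠ c p.1} k))
  · change ULift.up (MvPolynomial.aeval (fun _ => (0 : k)) (algebraMap k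
      (MvPolynomial {p : Δ × G // p.2 ≠ c p.1} k) x.down)) = x
    rw [AlgHom.commutes]
    rfl

end PartitionRing

/-! ### Complete resolutions from short exact sequences. -/

section Splicing

variable {k : Type} [CommRing k] {G : Type u} [Group G]

lemma rep_exact_iff (S : ShortComplex (Rep.{u} k G)) :
    S.Exact ↔ ∀ y : S.X₂, S.g.hom y = 0 → ∃ x : S.X₁, S.f.hom x = y := by
  rw [← S.exact_map_iff_of_faithful (forget₂ (Rep.{u} k G) (ModuleCat.{u} k)),
    ShortComplex.moduleCat_exact_iff]
  rfl

lemma rep_shortExact_injective {S : ShortComplex (Rep.{u} k G)} (hS : S.ShortExact) :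
    Function.Injective S.f.hom :=
  (Rep.mono_iff_injective _).1 hS.mono_f

lemma rep_shortExact_surjective {S : ShortComplex (Rep.{u} k G)} (hS : S.ShortExact) :
    Function.Surjective S.g.hom :=
  (Rep.epi_iff_surjective _).1 hS.epi_g

/-- A short exact sequence with projective middle term which stays exact under `Hom(-, Q)` for all
projective modules `Q`. -/
structure IsTotallyExact (S : ShortComplex (Rep.{u} k G)) : Prop where
  shortExact : S.ShortExact
  projective : Projective S.X₂
  extension : ∀ Q : Rep.{u} k G, Projective Q → ∀ f : S.X₁ ⟶ Q, ∃ g : S.X₂ ⟶ Q, S.f ≫ g = f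

/-- The complex spliced together from short complexes `Sᵢ` with `(Sᵢ₊₁).X₃ ≅ (Sᵢ).X₁`. -/
noncomputable abbrev splice (S : ℤ → ShortComplex (Rep.{u} k G))
    (e : ∀ i, (S (i + 1)).X₃ ≅ (S i).X₁) : ChainComplex (Rep.{u} k G) ℤ :=
  ChainComplex.of (fun i => (S i).X₂) (fun i => (S (i + 1)).g ≫ (e i).hom ≫ (S i).f)
    fun i => by simp

lemma splice_d (S : ℤ → ShortComplex (Rep.{u} k G)) (e : ∀ i, (S (i + 1)).X₃ ≅ (S i).X₁) (i : ℤ) :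
    (splice S e).d (i + 1) i = (S (i + 1)).g ≫ (e i).hom ≫ (S i).f :=
  ChainComplex.of_d (fun i => (S i).X₂) (fun i => (S (i + 1)).g ≫ (e i).hom ≫ (S i).f) i

lemma exists_splice_d_eq {S : ℤ → ShortComplex (Rep.{u} k G)} {e : ∀ i, (S (i + 1)).X₃ ≅ (S i).X₁}
    (hS : ∀ i, (S i).ShortExact) (i : ℤ) {y : (S i).X₂} (hy : (S i).g.hom y = 0) :
    ∃ x, ((splice S e).d (i + 1) i).hom x = y := by
  obtain ⟨z, rfl⟩ := (rep_exact_iff _).1 (hS i).exact y hy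
  obtain ⟨x, hx⟩ := rep_shortExact_surjective (hS (i + 1)) ((e i).inv.hom z)
  refine ⟨x, ?_⟩
  rw [splice_d]
  change (S i).f.hom ((e i).hom.hom ((S (i + 1)).g.hom x)) = _
  rw [hx, Rep.hom_inv_apply]

lemma isTotallyAcyclic_splice {S : ℤ → ShortComplex (Rep.{u} k G)}
    (e : ∀ i, (S (i + 1)).X₃ ≅ (S i).X₁) (hS : ∀ i, IsTotallyExact (S i)) :
    IsTotallyAcyclic (splice S e) where
  projective i := (hS i).projective
  acyclic i := by
    obtain ⟨i, rfl⟩ : ∃ j, i = j + 1 := ⟨i - 1, by simp⟩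
    rw [HomologicalComplex.exactAt_iff' _ (i + 1 + 1) (i + 1) i (by simp) (by simp), rep_exact_iff]
    intro y hy
    apply exists_splice_d_eq fun i => (hS i).shortExact
    change ((splice S e).d (i + 1) i).hom y = 0 at hy
    rw [splice_d] at hy
    change (S i).f.hom ((e i).hom.hom ((S (i + 1)).g.hom y)) = 0 at hy
    rw [map_eq_zero_iff _ (rep_shortExact_injective (hS i).shortExact)] at hy
    rw [← Rep.inv_hom_apply _ _ (e i) ((S (i + 1)).g.hom y), hy, map_zero]
  hom_acyclic Q hQ i f hf := by
    obtain ⟨i, rfl⟩ : ∃ j, i = j + 1 := ⟨i - 1, by simp⟩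
    have := (hS (i + 1)).shortExact.epi_g
    have := (hS (i + 1 + 1)).shortExact.epi_g
    rw [add_sub_cancel_right]
    rw [splice_d, Category.assoc, Category.assoc] at hf
    have hf' : (S (i + 1)).f ≫ f = 0 := by
      rw [← cancel_epi (e (i + 1)).hom, ← cancel_epi (S (i + 1 + 1)).g, hf]
      simp
    -- A cocycle `f` factors through the quotient of the middle term, which is the kernel term of
    -- the next sequence; total exactness of the latter extends it.
    obtain ⟨g, hg⟩ := (hS i).extension Q hQ
      ((e i).inv ≫ (hS (i + 1)).shortExact.exact.desc f hf')
    refine ⟨g, ?_⟩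
    rw [splice_d, Category.assoc, Category.assoc, hg, Iso.hom_inv_id_assoc]
    exact (hS (i + 1)).shortExact.exact.g_desc f hf'

lemma isGorensteinProjective_of_splice {S : ℤ → ShortComplex (Rep.{u} k G)}
    (e : ∀ i, (S (i + 1)).X₃ ≅ (S i).X₁) (hS : ∀ i, IsTotallyExact (S i)) {M : Rep.{u} k G}
    (e₀ : (S 0).X₃ ≅ M) : IsGorensteinProjective M := by
  have w : (splice S e).d 1 0 ≫ (S 0).g ≫ e₀.hom = 0 := by
    change (splice S e).d (0 + 1) 0 ≫ (S 0).g ≫ e₀.hom = 0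
    rw [splice_d S e 0]
    simp
  have := (hS 0).shortExact.epi_g
  refine ⟨splice S e, isTotallyAcyclic_splice e hS, (S 0).g ≫ e₀.hom, w, epi_comp _ _,
    (rep_exact_iff _).2 fun y hy => ?_⟩
  refine exists_splice_d_eq (e := e) (fun i => (hS i).shortExact) 0 (y := y) ?_
  change e₀.hom.hom ((S 0).g.hom y) = 0 at hy
  rw [← Rep.inv_hom_apply _ _ e₀ ((S 0).g.hom y), hy, map_zero]

/-- A class of modules in which every member can be continued to the left and to the right by
totally exact sequences consists of Gorenstein projective modules. -/
theorem isGorensteinProjective_of_class (C : Rep.{u} k G → Prop)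
    (hl : ∀ M, C M → ∃ S : ShortComplex (Rep.{u} k G),
      IsTotallyExact S ∧ C S.X₁ ∧ Nonempty (S.X₃ ≅ M))
    (hr : ∀ M, C M → ∃ S : ShortComplex (Rep.{u} k G),
      IsTotallyExact S ∧ C S.X₃ ∧ Nonempty (S.X₁ ≅ M))
    {M : Rep.{u} k G} (hM : C M) : IsGorensteinProjective M := by
  choose l hl hlC hle using fun M : Subtype C => hl M.1 M.2
  choose r hr hrC hre using fun M : Subtype C => hr M.1 M.2
  -- `K` and `K'` are the iterated syzygies and cosyzygies of `M`; both start at `M`, where the two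
  -- halves are glued between degrees `0` and `-1`.
  let K : ℕ → Subtype C := fun n => Nat.rec ⟨M, hM⟩ (fun _ K => ⟨(l K).X₁, hlC K⟩) n
  let K' : ℕ → Subtype C := fun n => Nat.rec ⟨M, hM⟩ (fun _ K => ⟨(r K).X₃, hrC K⟩) n
  let S : ℤ → ShortComplex (Rep.{u} k G) := fun i =>
    match i with
    | .ofNat n => l (K n)
    | .negSucc n => r (K' n)
  have e : ∀ i, Nonempty ((S (i + 1)).X₃ ≅ (S i).X₁) := fun i =>
    match i with
    | .ofNat n => hle (K (n + 1))
    | .negSucc 0 => ⟨(hle (K 0)).some ≪≫ (hre (K' 0)).some.symm⟩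
    | .negSucc (n + 1) => ⟨(hre (K' (n + 1))).some.symm⟩
  refine isGorensteinProjective_of_splice (S := S) (fun i => (e i).some) (fun i => ?_)
    (hle (K 0)).some
  match i with
  | .ofNat n => exact hl _
  | .negSucc n => exact hr _

end Splicing

/-! ### Sequences split over the ground ring. -/

section LinearSplitting

open scoped TensorProduct

variable {k : Type} [CommRing k] {G : Type u} [Group G]

/-- A short complex of `kG`-modules which is split exact as a sequence of `k`-modules. -/
def IsLinearlySplit (S : ShortComplex (Rep.{u} k G)) : Prop :=
  ∃ (r : S.X₂ →ₗ[k] S.X₁) (s : S.X₃ →ₗ[k] S.X₂), (∀ x, r (S.f.hom x) = x) ∧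
    (∀ z, S.g.hom (s z) = z) ∧ ∀ y, S.f.hom (r y) + s (S.g.hom y) = y

lemma IsLinearlySplit.shortExact {S : ShortComplex (Rep.{u} k G)} (hS : IsLinearlySplit S) :
    S.ShortExact := by
  obtain ⟨r, s, hr, hs, hrs⟩ := hS
  have : Mono S.f := (Rep.mono_iff_injective _).2 (Function.LeftInverse.injective hr)
  have : Epi S.g := (Rep.epi_iff_surjective _).2 (Function.RightInverse.surjective hs)
  refine ⟨(rep_exact_iff S).2 fun y hy => ⟨r y, ?_⟩⟩
  rw [← hrs y, hy, map_zero, add_zero, hr]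

lemma rep_zero_apply (S : ShortComplex (Rep.{u} k G)) (x : S.X₁) : S.g.hom (S.f.hom x) = 0 :=
  DFunLike.congr_fun (congrArg Rep.Hom.hom S.zero) x

lemma isLinearlySplit_of_section {S : ShortComplex (Rep.{u} k G)} (hS : S.ShortExact)
    (s : S.X₃ →ₗ[k] S.X₂) (hs : ∀ z, S.g.hom (s z) = z) : IsLinearlySplit S := by
  have hinj := rep_shortExact_injective hS
  let e := LinearEquiv.ofInjective S.f.hom.toLinearMap hinj
  have hmem : ∀ y, (LinearMap.id - s ∘ₗ S.g.hom.toLinearMap : S.X₂ →ₗ[k] S.X₂) y ∈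
      LinearMap.range S.f.hom.toLinearMap := fun y => by
    obtain ⟨x, hx⟩ := (rep_exact_iff S).1 hS.exact (y - s (S.g.hom y)) (by simp [hs])
    exact ⟨x, hx⟩
  let r : S.X₂ →ₗ[k] S.X₁ := e.symm.toLinearMap ∘ₗ LinearMap.codRestrict _ _ hmem
  have hr : ∀ y, S.f.hom (r y) = y - s (S.g.hom y) := fun y =>
    congrArg Subtype.val (e.apply_symm_apply ⟨_, hmem y⟩)
  refine ⟨r, s, fun x => hinj ?_, hs, fun y => by rw [hr, sub_add_cancel]⟩
  rw [hr, rep_zero_apply, map_zero, sub_zero]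

lemma isLinearlySplit_of_retraction {S : ShortComplex (Rep.{u} k G)} (hS : S.ShortExact)
    (r : S.X₂ →ₗ[k] S.X₁) (hr : ∀ x, r (S.f.hom x) = x) : IsLinearlySplit S := by
  have hsurj := rep_shortExact_surjective hS
  have hker : LinearMap.ker S.g.hom.toLinearMap ≤
      LinearMap.ker (LinearMap.id - S.f.hom.toLinearMap ∘ₗ r) := fun y hy => by
    obtain ⟨x, rfl⟩ := (rep_exact_iff S).1 hS.exact y hy
    simp [hr]
  let e := S.g.hom.toLinearMap.quotKerEquivOfSurjective hsurj
  let s : S.X₃ →ₗ[k] S.X₂ := (Submodule.liftQ _ _ hker) ∘ₗ e.symm.toLinearMap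
  have hs : ∀ y, s (S.g.hom y) = y - S.f.hom (r y) := fun y => by
    have : e.symm (S.g.hom y) = Submodule.Quotient.mk y :=
      e.symm_apply_eq.2 (LinearMap.quotKerEquivOfSurjective_apply_mk _ hsurj y).symm
    change Submodule.liftQ _ _ hker (e.symm (S.g.hom y)) = _
    rw [this]
    rfl
  refine ⟨r, s, hr, fun z => ?_, fun y => by rw [hs, add_sub_cancel]⟩
  obtain ⟨y, rfl⟩ := hsurj z
  rw [hs, map_sub, rep_zero_apply, sub_zero]

lemma IsLinearlySplit.tens_left {S : ShortComplex (Rep.{u} k G)} (hS : IsLinearlySplit S)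
    (M : Rep.{u} k G) : IsLinearlySplit (S.map (tensLeft M)) := by
  obtain ⟨r, s, hr, hs, hrs⟩ := hS
  have h1 : r ∘ₗ S.f.hom.toLinearMap = LinearMap.id := LinearMap.ext hr
  have h2 : S.g.hom.toLinearMap ∘ₗ s = LinearMap.id := LinearMap.ext hs
  have h3 : S.f.hom.toLinearMap ∘ₗ r + s ∘ₗ S.g.hom.toLinearMap = LinearMap.id :=
    LinearMap.ext hrs
  refine ⟨r.lTensor M, s.lTensor M, fun x => ?_, fun z => ?_, fun y => ?_⟩
  · change (r.lTensor M ∘ₗ S.f.hom.toLinearMap.lTensor M) x = x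
    rw [← LinearMap.lTensor_comp, h1, LinearMap.lTensor_id]
    rfl
  · change (S.g.hom.toLinearMap.lTensor M ∘ₗ s.lTensor M) z = z
    rw [← LinearMap.lTensor_comp, h2, LinearMap.lTensor_id]
    rfl
  · change (S.f.hom.toLinearMap.lTensor M ∘ₗ r.lTensor M +
      s.lTensor M ∘ₗ S.g.hom.toLinearMap.lTensor M) y = y
    rw [← LinearMap.lTensor_comp, ← LinearMap.lTensor_comp, ← LinearMap.lTensor_add, h3,
      LinearMap.lTensor_id]
    rfl

lemma IsLinearlySplit.projective₁ {S : ShortComplex (Rep.{u} k G)} (hS : IsLinearlySplit S)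
    (h : Module.Projective k S.X₂) : Module.Projective k S.X₁ := by
  obtain ⟨r, s, hr, hs, hrs⟩ := hS
  exact Module.Projective.of_split S.f.hom.toLinearMap r (LinearMap.ext hr)

lemma IsLinearlySplit.projective₃ {S : ShortComplex (Rep.{u} k G)} (hS : IsLinearlySplit S)
    (h : Module.Projective k S.X₂) : Module.Projective k S.X₃ := by
  obtain ⟨r, s, hr, hs, hrs⟩ := hS
  exact Module.Projective.of_split s S.g.hom.toLinearMap (LinearMap.ext hs)

/-- The augmentation `kΔ → k`. -/
noncomputable def permAug (k : Type) [CommRing k] (G : Type u) [Group G] (Δ : Type u)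
    [MulAction G Δ] : perm k G Δ ⟶ trivialModule k G :=
  Rep.ofHom ⟨permLift fun _ => ULift.up 1, fun g => by ext; simp⟩

lemma permAug_single (Δ : Type u) [MulAction G Δ] (δ : Δ) (a : k) :
    (permAug k G Δ).hom (MonoidAlgebra.single δ a) = a • ULift.up 1 :=
  permLift_single _ _ _

/-- The sequence `0 → J → kΔ → k → 0` for a nonempty `G`-set `Δ`. -/
lemma exists_augmentation_sequence (k : Type) [CommRing k] (G : Type u) [Group G] (Δ : Type u)
    [MulAction G Δ] [Nonempty Δ] : ∃ (J : Rep.{u} k G) (ι : J ⟶ perm k G Δ)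
      (w : ι ≫ permAug k G Δ = 0), IsLinearlySplit (ShortComplex.mk ι (permAug k G Δ) w) := by
  -- Since `δ` need not be fixed by `G`, the resulting section is only linear.
  let δ : Δ := Classical.arbitrary Δ
  let s : ULift.{u} k →ₗ[k] MonoidAlgebra k Δ :=
    LinearMap.toSpanSingleton k (MonoidAlgebra k Δ) (MonoidAlgebra.single δ 1) ∘ₗ
      ULift.moduleEquiv.toLinearMap
  have hs : ∀ z, (permAug k G Δ).hom (s z) = z := fun z => by
    refine ((permAug k G Δ).hom.toLinearMap.map_smul z.down
      (MonoidAlgebra.single δ (1 : k))).trans ?_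
    refine (congrArg (z.down • ·) ((permAug_single Δ δ (1 : k)).trans (one_smul k _))).trans ?_
    exact congrArg ULift.up (mul_one z.down)
  have : Epi (permAug k G Δ) :=
    (Rep.epi_iff_surjective _).2 (Function.RightInverse.surjective hs)
  have hS : (ShortComplex.mk _ _ (Limits.kernel.condition (permAug k G Δ))).ShortExact :=
    { exact := ShortComplex.exact_of_f_is_kernel _ (Limits.kernelIsKernel _) }
  exact ⟨_, _, _, isLinearlySplit_of_section hS s hs⟩

lemma permAug_tensTrivial {Δ : Type u} [MulAction G Δ] (M : Rep.{u} k G) :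
    tensMap (𝟙 M) (permAug k G Δ) ≫ (tensTrivial M).hom = tensAug Δ M := by
  refine tensPerm_hom_ext fun m δ => ?_
  change (tensTrivial M).hom.hom (m ⊗ₜ[k] (permAug k G Δ).hom (MonoidAlgebra.single δ 1)) = _
  rw [tensAug_tmul, permAug_single, tensTrivial_hom_tmul]
  simp

lemma projective_perm (Δ : Type u) [MulAction G Δ] : Module.Projective k (perm k G Δ) :=
  inferInstanceAs (Module.Projective k (MonoidAlgebra k Δ))

lemma projective_tens {M B : Rep.{u} k G} (hM : Module.Projective k M)
    (hB : Module.Projective k B) : Module.Projective k (tens M B) :=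
  inferInstanceAs (Module.Projective k (M ⊗[k] B))

/-- If `M` is projective over `k`, then `M ⊗ kG` is projective over `kG`. -/
lemma projective_tens_leftRegular {M : Rep.{u} k G} (hM : Module.Projective k M) :
    Projective (tens M (perm k G G)) where
  factors {E X} f e he := by
    obtain ⟨l, hl⟩ := Module.projective_lifting_property e.hom.toLinearMap
      (f.hom.toLinearMap ∘ₗ (TensorProduct.mk k M (MonoidAlgebra k G)).flip
        (MonoidAlgebra.single 1 1)) ((Rep.epi_iff_surjective e).1 he)
    have hl' : ∀ m : M, e.hom (l m) = f.hom (m ⊗ₜ[k] MonoidAlgebra.single 1 1) :=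
      LinearMap.congr_fun hl
    -- A linear lift on `M ⊗ 1` determines the equivariant one by conjugation.
    let φ : G → M →ₗ[k] E := fun g => E.ρ g ∘ₗ l ∘ₗ M.ρ g⁻¹
    have hφ : ∀ (g x : G) (m : M), φ (g • x) (M.ρ g m) = E.ρ g (φ x m) := fun g x m => by
      simp [φ]
    refine ⟨tensPermLift φ hφ, tensPerm_hom_ext fun m g => ?_⟩
    change e.hom ((tensPermLift φ hφ).hom (m ⊗ₜ[k] MonoidAlgebra.single g 1)) = _
    rw [tensPermLift_tmul, one_smul]
    change e.hom (E.ρ g (l (M.ρ g⁻¹ m))) = _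
    rw [Rep.hom_comm_apply, hl', ← Rep.hom_comm_apply]
    simp

end LinearSplitting

/-! ### `𝔉`-projective modules that are Gorenstein projective. -/

section RelativeProjective

open scoped TensorProduct

variable {k : Type} [CommRing k] {G : Type u} [Group G] {Δ : Type u} [MulAction G Δ]

lemma IsFProjective.of_retract {M N : Rep.{u} k G} (hN : IsFProjective k G Δ N)
    (h : Retract M N) : IsFProjective k G Δ M := by
  obtain ⟨L, ⟨r⟩⟩ := hN
  exact ⟨L, ⟨h.trans r⟩⟩

variable (Δ) in
lemma isFProjective_tens_perm (M : Rep.{u} k G) : IsFProjective k G Δ (tens M (perm k G Δ)) :=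
  ⟨M, ⟨Retract.refl _⟩⟩

lemma IsFProjective.tens_right {M : Rep.{u} k G} (hM : IsFProjective k G Δ M) (B : Rep.{u} k G) :
    IsFProjective k G Δ (tens M B) := by
  obtain ⟨L, ⟨r⟩⟩ := hM
  exact ⟨tens L B, ⟨(Retract.map r (tensRight B)).trans 
    (.ofIso (tensRightComm L (perm k G Δ) B))⟩⟩

lemma IsFProjective.biprod {M N : Rep.{u} k G} (hM : IsFProjective k G Δ M)
    (hN : IsFProjective k G Δ N) : IsFProjective k G Δ (M ⊞ N) := by
  obtain ⟨L, ⟨r⟩⟩ := hM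
  obtain ⟨L', ⟨r'⟩⟩ := hN
  have := Limits.preservesBinaryBiproduct_of_preservesBiproduct (tensRight (perm k G Δ)) L L'
  let e := (tensRight (perm k G Δ)).mapBiprod L L'
  refine ⟨L ⊞ L', ⟨Retract.trans ⟨Limits.biprod.map r.i r'.i, Limits.biprod.map r.r r'.r, ?_⟩
    (.ofIso e.symm)⟩⟩
  apply Limits.biprod.hom_ext' <;> simp

/-- The augmentation `M ⊗ kΔ → M` of an `𝔉`-projective module splits. -/
lemma IsFProjective.exists_section {M : Rep.{u} k G} (hM : IsFProjective k G Δ M) :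
    ∃ s : M ⟶ tens M (perm k G Δ), s ≫ tensAug Δ M = 𝟙 M := by
  obtain ⟨L, ⟨r⟩⟩ := hM
  change Retract M (tens L (perm k G Δ)) at r
  -- The diagonal `m ⊗ δ ↦ m ⊗ δ ⊗ δ` splits the augmentation of `L ⊗ kΔ`.
  let φ : Δ → L →ₗ[k] tens (tens L (perm k G Δ)) (perm k G Δ) := fun δ =>
    (TensorProduct.mk k (L ⊗[k] MonoidAlgebra k Δ) (MonoidAlgebra k Δ)).flip
        (MonoidAlgebra.single δ 1) ∘ₗ
      (TensorProduct.mk k L (MonoidAlgebra k Δ)).flip (MonoidAlgebra.single δ 1)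
  have hφ : ∀ (g : G) (δ : Δ) (m : L), φ (g • δ) (L.ρ g m) =
      (tens (tens L (perm k G Δ)) (perm k G Δ)).ρ g (φ δ m) := fun g δ m => by
    simp [φ]
  have h : tensPermLift φ hφ ≫ tensAug Δ (tens L (perm k G Δ)) = 𝟙 _ := by
    refine tensPerm_hom_ext fun m δ => ?_
    change (tensAug Δ (tens L (perm k G Δ))).hom
      ((tensPermLift φ hφ).hom (m ⊗ₜ[k] MonoidAlgebra.single δ 1)) = _
    rw [tensPermLift_tmul, one_smul]
    exact (tensAug_tmul _ _ _ _).trans (one_smul _ _)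
  refine ⟨r.i ≫ tensPermLift φ hφ ≫ tensMap r.r (𝟙 _), ?_⟩
  rw [Category.assoc, Category.assoc, tensAug_naturality, reassoc_of% h, r.retract]

/-- A projective `Q` is a retract of `Q ⊗ kG`, which inherits the partition of `kG`. -/
lemma HasPartition.of_projective {S : Δ → Finset G} (hS : IsFiniteTransporter S)
    {Q : Rep.{u} k G} (hQ : Projective Q) : HasPartition S Q := by
  have : Epi (tensAug G Q) := (Rep.epi_iff_surjective _).2 fun q =>
    ⟨q ⊗ₜ[k] MonoidAlgebra.single 1 1, (tensAug_tmul _ _ _ _).trans (one_smul _ _)⟩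
  exact (hS.hasPartition_leftRegular.tens_left Q).of_retract
    ⟨Projective.factorThru (𝟙 Q) (tensAug G Q), tensAug G Q, Projective.factorThru_comp _ _⟩

/-- An `𝔉`-projective module that is projective over `k` and has a partition of unity is
projective. -/
lemma IsFProjective.projective {S : Δ → Finset G} (hS : IsFiniteTransporter S)
    {M : Rep.{u} k G} (hM : IsFProjective k G Δ M) (hk : Module.Projective k M)
    (hP : HasPartition S M) : Projective M := by
  obtain ⟨s, hs⟩ := hM.exists_section
  obtain ⟨t, ht⟩ := hP.exists_section hS s hs
  have := projective_tens_leftRegular hk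
  exact Retract.projective ⟨t, tensAug G M, ht⟩

/-- Tensoring a `k`-split sequence with an `𝔉`-projective module yields a sequence which stays
exact under `Hom(-, Q)` for all projective modules `Q`. -/
lemma IsFProjective.isTotallyExact {S : Δ → Finset G} (hS : IsFiniteTransporter S)
    {M : Rep.{u} k G} (hM : IsFProjective k G Δ M) {T : ShortComplex (Rep.{u} k G)}
    (hT : IsLinearlySplit T) (hp : Projective (tens M T.X₂)) :
    IsTotallyExact (T.map (tensLeft M)) where
  shortExact := (hT.tens_left M).shortExact
  projective := hp
  extension Q hQ f := by
    obtain ⟨r, -, hr, -⟩ := hT.tens_left M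
    obtain ⟨s, hs⟩ := hM.exists_section
    change tens M T.X₁ ⟶ Q at f
    change ∃ g : tens M T.X₂ ⟶ Q, tensMap (𝟙 M) T.f ≫ g = f
    obtain ⟨F, hF⟩ := (HasPartition.of_projective hS hQ).exists_extension hS
      (tensMap (𝟙 M) T.f) r hr f
    -- The section for `M` induces sections for all `M ⊗ B`, natural in `B`; precomposing `F` with
    -- `t` removes the factor `kΔ`.
    let t : ∀ B, tens M B ⟶ tens (tens M B) (perm k G Δ) := fun B =>
      tensMap s (𝟙 B) ≫ (tensRightComm _ _ _).hom
    have ht : ∀ B, t B ≫ tensAug Δ _ = 𝟙 _ := fun B => by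
      have : (tensRightComm M (perm k G Δ) B).hom ≫ tensAug Δ (tens M B) =
          tensMap (tensAug Δ M) (𝟙 B) := by
        rw [← Iso.eq_inv_comp]
        refine tensPerm_hom_ext fun x δ => ?_
        induction x using TensorProduct.induction_on with
        | zero => rw [TensorProduct.zero_tmul, map_zero, map_zero]
        | add x y hx hy => rw [TensorProduct.add_tmul, map_add, map_add, hx, hy]
        | tmul m b =>
          rw [tensAug_tmul, one_smul]
          change _ = (tensAug Δ M).hom (m ⊗ₜ[k] MonoidAlgebra.single δ 1) ⊗ₜ[k] b
          rw [tensAug_tmul, one_smul]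
      rw [Category.assoc, this, ← tensMap_comp, hs, Category.comp_id, tensMap_id]
    have hnat : tensMap (𝟙 M) T.f ≫ t T.X₂ =
        t T.X₁ ≫ tensMap (tensMap (𝟙 M) T.f) (𝟙 _) := by
      refine tens_hom_ext fun m b => ?_
      change (tensRightComm _ _ _).hom.hom (s.hom m ⊗ₜ[k] T.f.hom b) =
        (tensMap (tensMap (𝟙 M) T.f) (𝟙 _)).hom ((tensRightComm _ _ _).hom.hom (s.hom m ⊗ₜ[k] b))
      induction (s.hom m : M ⊗[k] MonoidAlgebra k Δ) using TensorProduct.induction_on with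
      | zero => simp
      | add x y hx hy => simp only [TensorProduct.add_tmul, map_add, hx, hy]
      | tmul x δ => rfl
    refine ⟨t T.X₂ ≫ F, ?_⟩
    rw [reassoc_of% hnat, hF, reassoc_of% (ht T.X₁)]

/-- An `𝔉`-projective module which is projective over `k` is Gorenstein projective. -/
theorem IsFProjective.isGorensteinProjective {S : Δ → Finset G} (hS : IsFiniteTransporter S)
    {M : Rep.{u} k G} (hM : IsFProjective k G Δ M) (hk : Module.Projective k M) :
    IsGorensteinProjective M := by
  refine isGorensteinProjective_of_class
    (fun M => IsFProjective k G Δ M ∧ Module.Projective k M) ?_ ?_ ⟨hM, hk⟩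
  · rintro M ⟨hM, hk⟩
    obtain ⟨J, ι, w, hT⟩ := exists_augmentation_sequence k G G
    exact ⟨_, hM.isTotallyExact hS hT (projective_tens_leftRegular hk),
      ⟨hM.tens_right J, projective_tens hk (hT.projective₁ (projective_perm G))⟩, ⟨tensTrivial M⟩⟩
  · rintro M ⟨hM, hk⟩
    -- The embedding `M → M ⊗ A` gives the step to the right: the partition on `A` makes `M ⊗ A`
    -- projective.
    obtain ⟨A, η, r, hP, hA, hr⟩ := hS.exists_unit k
    have : Mono η := (Rep.mono_iff_injective _).2 (Function.LeftInverse.injective hr)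
    have hT := isLinearlySplit_of_retraction
      (S := ShortComplex.mk _ _ (Limits.cokernel.condition η))
      { exact := ShortComplex.exact_of_g_is_cokernel _ (Limits.cokernelIsCokernel _) } r hr
    exact ⟨_, hM.isTotallyExact hS hT
        ((hM.tens_right A).projective hS (projective_tens hk hA) (hP.tens_left M)),
      ⟨hM.tens_right _, projective_tens hk (hT.projective₃ hA)⟩, ⟨tensTrivial M⟩⟩

end RelativeProjective

/-! ### Comparison with the standard resolution. -/

section Dimension

/-- Schanuel's lemma: if the last maps of two short exact sequences ending in the same object factor
through each other, then the kernel of one is a retract of the direct sum of the other kernel and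
a middle term. -/
lemma nonempty_retract_of_factors {C : Type*} [Category* C] [Abelian C] {K P K' P' M : C}
    {f : K ⟶ P} {g : P ⟶ M} {w : f ≫ g = 0} (h : (ShortComplex.mk f g w).ShortExact)
    {f' : K' ⟶ P'} {g' : P' ⟶ M} {w' : f' ≫ g' = 0} (h' : (ShortComplex.mk f' g' w').ShortExact)
    (a : P' ⟶ P) (ha : a ≫ g = g') (b : P ⟶ P') (hb : b ≫ g' = g) :
    Nonempty (Retract K (K' ⊞ P)) := by
  have := h.mono_f
  have := h'.mono_f
  let u : K ⟶ K' := h'.exact.lift (f ≫ b) (by simp [hb, w])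
  have hu : u ≫ f' = f ≫ b := h'.exact.lift_f _ _
  let v : K' ⟶ K := h.exact.lift (f' ≫ a) (by simp [ha, w'])
  have hv : v ≫ f = f' ≫ a := h.exact.lift_f _ _
  let t : P ⟶ K := h.exact.lift (𝟙 P - b ≫ a) (by simp [ha, hb])
  have ht : t ≫ f = 𝟙 P - b ≫ a := h.exact.lift_f _ _
  -- After composing with the monomorphism `f`, this is `f ≫ b ≫ a + f ≫ (𝟙 P - b ≫ a) = f`.
  refine ⟨⟨Limits.biprod.lift u f, Limits.biprod.desc v t, ?_⟩⟩
  rw [Limits.biprod.lift_desc, ← cancel_mono (ShortComplex.mk f g w).f]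
  change (u ≫ v + f ≫ t) ≫ f = 𝟙 K ≫ f
  rw [Preadditive.add_comp, Category.assoc, Category.assoc, hv, ht, reassoc_of% hu]
  simp

variable {k : Type} [CommRing k] {G : Type u} [Group G] {Δ : Type u} [MulAction G Δ]

variable (Δ) in
/-- The `n`-fold tensor product of `M` with `J` is `𝔉`-projective. -/
def IsFProjectiveAfter (J : Rep.{u} k G) : ℕ → Rep.{u} k G → Prop
  | 0, M => IsFProjective k G Δ M
  | n + 1, M => IsFProjectiveAfter J n (tens M J)

lemma IsFProjectiveAfter.of_retract {J : Rep.{u} k G} {n : ℕ} {M N : Rep.{u} k G}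
    (hN : IsFProjectiveAfter Δ J n N) (h : Retract M N) : IsFProjectiveAfter Δ J n M := by
  induction n generalizing M N with
  | zero => exact IsFProjective.of_retract hN h
  | succ n ih => exact ih hN (h.map (tensRight J))

lemma IsFProjectiveAfter.of_isFProjective (J : Rep.{u} k G) (n : ℕ) {M : Rep.{u} k G}
    (hM : IsFProjective k G Δ M) : IsFProjectiveAfter Δ J n M := by
  induction n generalizing M with
  | zero => exact hM
  | succ n ih => exact ih (hM.tens_right J)

lemma IsFProjectiveAfter.biprod {J : Rep.{u} k G} {n : ℕ} {M N : Rep.{u} k G}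
    (hM : IsFProjectiveAfter Δ J n M) (hN : IsFProjectiveAfter Δ J n N) :
    IsFProjectiveAfter Δ J n (M ⊞ N) := by
  induction n generalizing M N with
  | zero => exact IsFProjective.biprod hM hN
  | succ n ih =>
    have := Limits.preservesBinaryBiproduct_of_preservesBiproduct (tensRight J) M N
    exact (ih hM hN).of_retract (.ofIso ((tensRight J).mapBiprod M N))

lemma exists_tensAug_sequence {J : Rep.{u} k G} {ι : J ⟶ perm k G Δ} {w : ι ≫ permAug k G Δ = 0}
    (hJ : IsLinearlySplit (ShortComplex.mk ι (permAug k G Δ) w)) (M : Rep.{u} k G) :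
    ∃ w' : tensMap (𝟙 M) ι ≫ tensAug Δ M = 0,
      (ShortComplex.mk (tensMap (𝟙 M) ι) (tensAug Δ M) w').ShortExact := by
  have h : tensMap (𝟙 M) ι ≫ tensMap (𝟙 M) (permAug k G Δ) = 0 :=
    ((tensLeft M).map_comp _ _).symm.trans ((congrArg _ w).trans ((tensLeft M).map_zero _ _))
  have hT : (ShortComplex.mk _ _ h).ShortExact := (hJ.tens_left M).shortExact
  have w' : tensMap (𝟙 M) ι ≫ tensAug Δ M = 0 := by
    rw [← permAug_tensTrivial, reassoc_of% h, Limits.zero_comp]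
  refine ⟨w', ShortComplex.shortExact_of_iso (S₁ := ShortComplex.mk _ _ h)
    (ShortComplex.isoMk (S₂ := ShortComplex.mk _ _ w') (Iso.refl _) (Iso.refl _)
      (tensTrivial M) ?_ ?_) hT⟩
  · exact (Category.id_comp _).trans (Category.comp_id _).symm
  · exact (Category.id_comp _).trans (permAug_tensTrivial M).symm

/-- At each step Schanuel's lemma compares the given sequence with `0 → X₃ ⊗ J → X₃ ⊗ kΔ → X₃ → 0`.
The `𝔉`-splitting provides the map `X₃ ⊗ kΔ → X₂` over `X₃`, and `𝔉`-projectivity of `X₂` the map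
back. So `X₃ ⊗ J` is a retract of `X₁ ⊞ (X₃ ⊗ kΔ)`, and induction applies to `X₁`. -/
lemma HasResolution.isFProjectiveAfter {J : Rep.{u} k G} {ι : J ⟶ perm k G Δ}
    {w : ι ≫ permAug k G Δ = 0}
    (hJ : IsLinearlySplit (ShortComplex.mk ι (permAug k G Δ) w)) {n : ℕ} {M : Rep.{u} k G}
    (h : HasResolution (IsFProjective k G Δ) (IsFSplit k G Δ) n M) :
    IsFProjectiveAfter Δ J n M := by
  induction h with
  | zero M hM => exact hM
  | succ n S hS h₂ h₁ ih =>
    obtain ⟨hex, ⟨σ⟩⟩ := hS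
    obtain ⟨w', hM⟩ := exists_tensAug_sequence hJ S.X₃
    obtain ⟨s, hs⟩ := h₂.exists_section
    let b : tens S.X₃ (perm k G Δ) ⟶ tens S.X₂ (perm k G Δ) := σ.s
    have hb : b ≫ tensMap S.g (𝟙 _) = 𝟙 _ := σ.s_g
    obtain ⟨r⟩ := nonempty_retract_of_factors hM hex (s ≫ tensMap S.g (𝟙 _))
      (by rw [Category.assoc, tensAug_naturality, reassoc_of% hs])
      (b ≫ tensAug Δ S.X₂) (by rw [Category.assoc, ← tensAug_naturality, reassoc_of% hb])
    exact (ih.biprod (.of_isFProjective J n (isFProjective_tens_perm Δ S.X₃))).of_retract r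

/-- Tensoring with `kΔ` and with `J` preserves `k`-projectivity, so every term of the standard
resolution, including the last, is Gorenstein projective. -/
lemma IsFProjectiveAfter.hasResolution {S : Δ → Finset G} (hS : IsFiniteTransporter S)
    {J : Rep.{u} k G} {ι : J ⟶ perm k G Δ} {w : ι ≫ permAug k G Δ = 0}
    (hJ : IsLinearlySplit (ShortComplex.mk ι (permAug k G Δ) w)) {n : ℕ} {M : Rep.{u} k G}
    (hk : Module.Projective k M) (hM : IsFProjectiveAfter Δ J n M) :
    HasResolution IsGorensteinProjective ShortComplex.ShortExact n M := by
  induction n generalizing M with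
  | zero => exact .zero M (IsFProjective.isGorensteinProjective hS hM hk)
  | succ n ih =>
    obtain ⟨w', hex⟩ := exists_tensAug_sequence hJ M
    exact .succ n _ hex
      ((isFProjective_tens_perm Δ M).isGorensteinProjective hS
        (projective_tens hk (projective_perm Δ)))
      (ih (projective_tens hk (hJ.projective₁ (projective_perm Δ))) hM)

end Dimension

theorem mainTheorem8 (G : Type u) [Group G] (Δ : Type u) [MulAction G Δ]
    (hΔ : IsFiniteSubgroupGSet G Δ) :
    gorensteinCohomologicalDimension G ≤ fCohomologicalDimension G Δ := by
  -- The trivial subgroup is finite, so it has a fixed point in `Δ`; conversely each stabilizer has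
  -- one, so it is finite.
  have : Nonempty Δ := ((hΔ ⊥).2 inferInstance).nonempty
  obtain ⟨S, hS⟩ := exists_isFiniteTransporter fun δ : Δ =>
    (hΔ (MulAction.stabilizer G δ)).1 ⟨δ, fun _ h => h⟩
  obtain ⟨J, ι, w, hJ⟩ := exists_augmentation_sequence ℤ G Δ
  refine le_iInf₂ fun n hn => iInf₂_le n ?_
  have hk : Module.Projective ℤ (trivialModule ℤ G) :=
    inferInstanceAs (Module.Projective ℤ (ULift.{u} ℤ))
  exact (hn.isFProjectiveAfter hJ).hasResolution hS hJ hk
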